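/- Let $(X,\mu)$ be a standard probability space with non-atomic measure. Call a function $\rho:X\times X\to\mathbb{R}$ an admissible semimetric if it is $(\mu\times\mu)$-integrable and there is a measurable set $X'\subset X$ of full measure such that: $\rho$ is a semimetric on $X'$ (nonnegative, symmetric, zero on the diagonal, satisfying the triangle inequality); $(\mu\times\mu)\{(x,x):x\in X'\}=0$; and the completion of the metric space obtained from $(X',\rho)$ by identifying points at distance zero is a Polish space on which $\mu$ induces a Borel probability measure (that is, Borel subsets of the completion have $\mu$-measurable preimages in $X'$). Call $\rho$ an admissible metric if moreover $X'$ can be chosen so that $\rho(x,y)=0$ implies $x=y$ for $x,y\in X'$. Call $\rho$ $T$-invariant if $\rho(Tx,Ty)=\rho(x,y)$ for $(\mu\times\mu)$-almost all $(x,y)$. Let $T$ be an ergodic automorphism of $(X,\mu)$ (a measure-preserving transformation, invertible mod $0$), and let $U_Tf=f\circ T$ be its Koopman operator on $L^2(X,\mu;\mathbb{C})$. (a) If there is a $T$-invariant admissible semimetric $\rho$ that is not zero almost everywhere, then the spectrum of $T$ contains a nontrivial discrete component: $U_T$ has an eigenfunction in the orthogonal complement of the constants. (b) If there is a $T$-invariant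 admissible metric, then the spectrum of $T$ is purely discrete: the eigenfunctions of $U_T$ span a dense subspace of $L^2(X,\mu;\mathbb{C})$. Moreover $T$ is isomorphic mod $0$ to a translation $x\mapsto gx$ on a compact (Hausdorff) abelian group $G$ with normalized Haar measure, where the powers of $g$ form a dense subgroup of $G$. -/

import Mathlib

open MeasureTheory

noncomputable section

/-- `ρ` is a semimetric, in the ordinary sense, on the set `S`. -/
structure IsSemimetricOn {X : Type*} (ρ : X → X → ℝ) (S : Set X) : Prop where
  nonneg : ∀ x ∈ S, ∀ y ∈ S, 0 ≤ ρ x y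
  self : ∀ x ∈ S, ρ x x = 0
  symm : ∀ x ∈ S, ∀ y ∈ S, ρ x y = ρ y x
  triangle : ∀ x ∈ S, ∀ y ∈ S, ∀ z ∈ S, ρ x z ≤ ρ x y + ρ y z

/-- The pseudometric space `(S, ρ)`. -/
abbrev IsSemimetricOn.toPseudoMetricSpace {X : Type*} {ρ : X → X → ℝ} {S : Set X}
    (h : IsSemimetricOn ρ S) : PseudoMetricSpace S where
  dist x y := ρ x y
  dist_self x := h.self x x.2
  dist_comm x y := h.symm x x.2 y y.2
  dist_triangle x y z := h.triangle x x.2 y y.2 z z.2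

/-- The completion of the quotient metric space of `(S, d)` is a Polish space, and the measure
induced by `μ` on it is a Borel measure. (`UniformSpace.Completion` is the Hausdorff completion, so
points at distance zero are identified. Borel sets of the completion have to pull back to sets that
are measurable for the completion of `μ`.) -/
def HasPolishCompletion {X : Type*} [MeasurableSpace X] (μ : Measure X) (S : Set X)
    (d : PseudoMetricSpace S) : Prop :=
  letI := d
  letI : MeasurableSpace (UniformSpace.Completion S) := borel (UniformSpace.Completion S)
  PolishSpace (UniformSpace.Completion S) ∧
    AEMeasurable (fun x : S => (x : UniformSpace.Completion S)) (μ.comap Subtype.val)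

/-- `ρ` is an admissible semimetric, with `S` as the set of full measure on which the axioms of a
semimetric hold. -/
structure IsAdmissibleOn {X : Type*} [MeasurableSpace X] (μ : Measure X) (ρ : X → X → ℝ)
    (S : Set X) : Prop where
  measurableSet : MeasurableSet S
  full : ∀ᵐ x ∂μ, x ∈ S
  semimetric : IsSemimetricOn ρ S
  diagonal : μ.prod μ {p : X × X | p.1 ∈ S ∧ p.2 = p.1} = 0
  integrable : Integrable (fun p : X × X => ρ p.1 p.2) (μ.prod μ)
  polish : HasPolishCompletion μ S semimetric.toPseudoMetricSpace

/-- Admissible semimetrics on the measure space `(X, μ)`. -/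
def IsAdmissibleSemimetric {X : Type*} [MeasurableSpace X] (μ : Measure X)
    (ρ : X → X → ℝ) : Prop :=
  ∃ S : Set X, IsAdmissibleOn μ ρ S

/-- Admissible metrics on `(X, μ)`: admissible semimetrics that separate the points of a set of
full measure. -/
def IsAdmissibleMetric {X : Type*} [MeasurableSpace X] (μ : Measure X)
    (ρ : X → X → ℝ) : Prop :=
  ∃ S : Set X, IsAdmissibleOn μ ρ S ∧ ∀ x ∈ S, ∀ y ∈ S, ρ x y = 0 → x = y

/-- `ρ` is `T`-invariant, as a class of functions on `(X × X, μ × μ)`. -/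
def IsInvariantSemimetric {X : Type*} [MeasurableSpace X] (μ : Measure X) (T : X → X)
    (ρ : X → X → ℝ) : Prop :=
  ∀ᵐ p ∂(μ.prod μ), ρ (T p.1) (T p.2) = ρ p.1 p.2

/-- `φ` and `ψ` are mutually inverse (mod 0) isomorphisms of the measure spaces `(X, μ)`
and `(Y, ν)`. -/
structure IsIsoModZero {X Y : Type*} [MeasurableSpace X] [MeasurableSpace Y] (μ : Measure X)
    (ν : Measure Y) (φ : X → Y) (ψ : Y → X) : Prop where
  map : MeasurePreserving φ μ ν
  inv : MeasurePreserving ψ ν μ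
  left_inv : ∀ᵐ x ∂μ, ψ (φ x) = x
  right_inv : ∀ᵐ y ∂ν, φ (ψ y) = y

/-- Automorphisms of a measure space: measure-preserving maps that are invertible mod 0. -/
def IsAutomorphism {X : Type*} [MeasurableSpace X] (μ : Measure X) (T : X → X) : Prop :=
  ∃ S : X → X, IsIsoModZero μ μ T S

/-- `(X, μ, T)` and `(Y, ν, R)` are metrically isomorphic (mod 0). -/
def MetricallyIsomorphic {X Y : Type*} [MeasurableSpace X] [MeasurableSpace Y] (μ : Measure X)
    (T : X → X) (ν : Measure Y) (R : Y → Y) : Prop :=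
  ∃ (φ : X → Y) (ψ : Y → X), IsIsoModZero μ ν φ ψ ∧ ∀ᵐ x ∂μ, φ (T x) = R (φ x)

/-- The Koopman operator `f ↦ f ∘ T` on the complex space `L²(μ)`. -/
def koopman {X : Type*} [MeasurableSpace X] {μ : Measure X} {T : X → X}
    (hT : MeasurePreserving T μ μ) : Module.End ℂ (Lp ℂ 2 μ) :=
  (Lp.compMeasurePreservingₗᵢ ℂ T hT).toLinearMap

/-- The spectrum of `T` contains a discrete component: on the orthogonal complement of the
constants the Koopman operator has an eigenfunction. -/
def HasDiscreteComponent {X : Type*} [MeasurableSpace X] {μ : Measure X} [IsFiniteMeasure μ]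
    {T : X → X} (hT : MeasurePreserving T μ μ) : Prop :=
  ∃ (c : ℂ) (f : Lp ℂ 2 μ), Module.End.HasEigenvector (koopman hT) c f ∧
    inner ℂ (Lp.const 2 μ (1 : ℂ)) f = 0

/-- The spectrum of `T` is (purely) discrete: the eigenfunctions of the Koopman operator span a
dense subspace of `L²(μ)`. -/
def HasPurelyDiscreteSpectrum {X : Type*} [MeasurableSpace X] {μ : Measure X} {T : X → X}
    (hT : MeasurePreserving T μ μ) : Prop :=
  (⨆ c : ℂ, Module.End.eigenspace (koopman hT) c).topologicalClosure = ⊤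

end

/-!
The invariant semimetric turns `T` into an isometry of a compact metric space, and both parts are
read off from that isometry.

An admissible semimetric is, off a null set, the pullback of the metric of a Polish space under a
measurable map `p`. Almost everywhere invariance of the distances makes `T` induce an isometry `τ`
of the support `Z` of the distribution `ν` of `p` (`exists_isIsometricFactor_support`). Since `T` is
ergodic, `τ` has a dense orbit; since `τ` preserves both the metric and `ν`, balls of a fixed radius
have measure bounded below, so `Z` is totally bounded, hence compact
(`IsAdmissibleOn.exists_isIsometricFactor`).

On `L²(Z, ν)` the integral operators whose kernel is a function of the distance are compact,
self-adjoint, and commute with the Koopman operator of `τ`. By the spectral theorem for compact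
operators they vanish on the orthogonal complement of the eigenfunctions of the Koopman operator
(`eq_zero_of_isCompactOperator_of_commute`); concentrating the kernels at the diagonal shows that
this complement is zero (`hasPurelyDiscreteSpectrum_of_isometry`). If the semimetric is not zero
almost everywhere then `Z` has two points, and a nonconstant eigenfunction exists and can be pulled
back to `X`. If it is a metric, the factor map is injective on a set of full measure, so it is an
isomorphism by the Lusin–Souslin theorem and the whole spectrum is discrete.

The compact group is the completion of `ℤ` for the seminorm `n ↦ dist (τⁿ z₀) z₀`, where `z₀` has a
dense orbit: `n ↦ τⁿ z₀` extends to an isometry of this group onto `Z`, and `ν` corresponds to a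
measure that is invariant under the powers of the generator, hence under all translations
(`exists_rotation_of_isometry`).
-/

open Module.End
open UniformSpace (Completion)
open scoped BoundedContinuousFunction

universe u

/-! ### Compact operators commuting with an isometry -/

/-- A compact self-adjoint operator that commutes with a linear isometry `U` vanishes on every
vector orthogonal to all eigenvectors of `U`: on that orthogonal complement, a nonzero eigenvalue
would have a finite-dimensional `U`-invariant eigenspace, in which `U` has an eigenvector. -/
theorem eq_zero_of_isCompactOperator_of_commute {H : Type*} [NormedAddCommGroup H]
    [InnerProductSpace ℂ H] [CompleteSpace H] (U : H →ₗᵢ[ℂ] H) (K : H →L[ℂ] H)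
    (hK : IsCompactOperator K) (hsymm : (K : H →ₗ[ℂ] H).IsSymmetric)
    (hcomm : ∀ f, K (U f) = U (K f)) {f : H}
    (hf : f ∈ (⨆ c : ℂ, eigenspace U.toLinearMap c)ᗮ) : K f = 0 := by
  set N : Submodule ℂ H := (⨆ c : ℂ, eigenspace U.toLinearMap c)ᗮ with hN
  have hmem (g : H) : g ∈ N ↔ ∀ (c : ℂ) (u : H), U u = c • u → inner ℂ u g = 0 := by
    rw [hN, ← Submodule.iInf_orthogonal]
    simp [Submodule.mem_iInf, Submodule.mem_orthogonal]
  -- `U` need not be invertible: `U` scales `u` and `⟪U u, U g⟫ = ⟪u, g⟫`.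
  have hUN : ∀ g ∈ N, U.toLinearMap g ∈ N := by
    intro g hg
    rw [hmem] at hg ⊢
    intro c u hu
    by_cases hc : c = 0
    · have : u = 0 := by
        apply U.injective
        rw [hu, hc, zero_smul, map_zero]
      simp [this]
    · have h := hg c u hu
      rw [← U.inner_map_map, hu, inner_smul_left] at h
      simpa [hc] using h
  have hKN : ∀ g ∈ N, (K : H →ₗ[ℂ] H) g ∈ N := by
    intro g hg
    rw [hmem] at hg ⊢
    intro c u hu
    rw [← hsymm u g]
    refine hg c (K u) ?_
    rw [← hcomm, hu, map_smul]
  let S : N →L[ℂ] N := K.restrict hKN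
  have hS_compact : IsCompactOperator S := hK.restrict' hKN
  have hS_symm : (S : N →ₗ[ℂ] N).IsSymmetric := hsymm.restrict_invariant hKN
  have hS : S = 0 := by
    rw [← ContinuousLinearMap.eq_zero_of_forall_hasEigenvalue_eq_zero hS_compact hS_symm]
    intro c hc
    by_contra hc0
    have hfin := ContinuousLinearMap.finite_dimensional_eigenspace hS_compact c hc0
    let V : N →ₗ[ℂ] N := U.toLinearMap.restrict hUN
    have hV : ∀ v ∈ eigenspace (S : N →ₗ[ℂ] N) c, V v ∈ eigenspace (S : N →ₗ[ℂ] N) c := by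
      intro v hv
      rw [mem_eigenspace_iff] at hv ⊢
      apply Subtype.ext
      have hv' : K v = c • (v : H) := congrArg Subtype.val hv
      change K (U v) = c • U v
      rw [hcomm, hv', map_smul]
    have : Nontrivial (eigenspace (S : N →ₗ[ℂ] N) c) :=
      Submodule.nontrivial_iff_ne_bot.2 hc
    obtain ⟨d, hd⟩ := Module.End.exists_eigenvalue (V.restrict hV)
    obtain ⟨v, hv⟩ := hd.exists_hasEigenvector
    have hUv : U (v : N) = d • ((v : N) : H) :=
      congrArg (fun w : eigenspace (S : N →ₗ[ℂ] N) c => ((w : N) : H)) hv.apply_eq_smul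
    have h0 := (hmem _).1 (v : N).2 d _ hUv
    rw [inner_self_eq_zero] at h0
    exact hv.2 (Subtype.ext (Subtype.ext h0))
  simpa [S] using congrArg Subtype.val (congrArg (fun A : N →L[ℂ] N => A ⟨f, hf⟩) hS)

/-! ### Integral operators with continuous kernels -/

/-- The operator sending `f` to the function `x ↦ ⟪κ x, f⟫`, for a continuous family `κ` of vectors
over a compact space. -/
noncomputable def innerFamily {Z H : Type*} [TopologicalSpace Z] [CompactSpace Z]
    [NormedAddCommGroup H] [InnerProductSpace ℂ H] (κ : C(Z, H)) : H →L[ℂ] (Z →ᵇ ℂ) :=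
  LinearMap.mkContinuous
    { toFun := fun f => BoundedContinuousFunction.mkOfCompact
        ⟨fun x => inner ℂ (κ x) f, κ.continuous.inner continuous_const⟩
      map_add' := fun f g => by ext x; simp
      map_smul' := fun c f => by ext x; simp } ‖κ‖
    (fun f => by
      rw [BoundedContinuousFunction.norm_le (by positivity)]
      intro x
      refine (norm_inner_le_norm _ _).trans ?_
      gcongr
      exact κ.norm_coe_le_norm x)

@[simp]
theorem innerFamily_apply {Z H : Type*} [TopologicalSpace Z] [CompactSpace Z]
    [NormedAddCommGroup H] [InnerProductSpace ℂ H] (κ : C(Z, H)) (f : H) (x : Z) :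
    innerFamily κ f x = inner ℂ (κ x) f := rfl

/-- The unit ball has a bounded equicontinuous image, so this is the Arzelà–Ascoli theorem. -/
theorem isCompactOperator_innerFamily {Z H : Type*} [TopologicalSpace Z] [CompactSpace Z]
    [NormedAddCommGroup H] [InnerProductSpace ℂ H] (κ : C(Z, H)) :
    IsCompactOperator (innerFamily κ) := by
  refine ⟨closure (innerFamily κ '' Metric.ball 0 1), ?_,
    Filter.mem_of_superset (Metric.ball_mem_nhds 0 one_pos)
      fun f hf => subset_closure ⟨f, hf, rfl⟩⟩
  refine BoundedContinuousFunction.arzela_ascoli (Metric.closedBall 0 ‖κ‖)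
    (isCompact_closedBall _ _) _ ?_ ?_
  · rintro _ x ⟨f, hf, rfl⟩
    rw [mem_closedBall_zero_iff, innerFamily_apply]
    rw [mem_ball_zero_iff] at hf
    calc ‖inner ℂ (κ x) f‖ ≤ ‖κ x‖ * ‖f‖ := norm_inner_le_norm _ _
      _ ≤ ‖κ‖ * 1 := by gcongr; exact κ.norm_coe_le_norm x
      _ = ‖κ‖ := mul_one _
  · intro x
    rw [Metric.equicontinuousAt_iff_right]
    intro ε hε
    filter_upwards [Metric.tendsto_nhds.1 κ.continuous.continuousAt ε hε] with y hy
    rintro ⟨_, f, hf, rfl⟩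
    rw [mem_ball_zero_iff] at hf
    rw [dist_comm, dist_eq_norm] at hy
    change dist (inner ℂ (κ x) f) (inner ℂ (κ y) f) < ε
    rw [dist_eq_norm, ← inner_sub_left]
    calc ‖inner ℂ (κ x - κ y) f‖ ≤ ‖κ x - κ y‖ * ‖f‖ := norm_inner_le_norm _ _
      _ ≤ ‖κ x - κ y‖ * 1 := by gcongr
      _ < ε := by rwa [mul_one]

section IntegralOperator

variable {Z : Type*} [TopologicalSpace Z] [CompactSpace Z]
  [MeasurableSpace Z] [BorelSpace Z] (ν : Measure Z) [IsFiniteMeasure ν]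

/-- The family of vectors `x ↦ k x` of `L²(ν)` given by a continuous kernel `k`. -/
noncomputable def kernelFamily (k : C(Z, C(Z, ℂ))) : C(Z, Lp ℂ 2 ν) :=
  ⟨fun x => ContinuousMap.toLp 2 ν ℂ (k x), (ContinuousMap.toLp 2 ν ℂ).continuous.comp k.continuous⟩

/-- The integral operator on `L²(ν)` with the continuous kernel `conj (k x y)`. -/
noncomputable def integralOperator (k : C(Z, C(Z, ℂ))) : Lp ℂ 2 ν →L[ℂ] Lp ℂ 2 ν :=
  (BoundedContinuousFunction.toLp 2 ν ℂ).comp (innerFamily (kernelFamily ν k))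

theorem isCompactOperator_integralOperator (k : C(Z, C(Z, ℂ))) :
    IsCompactOperator (integralOperator ν k) :=
  (isCompactOperator_innerFamily (kernelFamily ν k)).clm_comp
    (BoundedContinuousFunction.toLp 2 ν ℂ : (Z →ᵇ ℂ) →L[ℂ] Lp ℂ 2 ν)

theorem coeFn_integralOperator (k : C(Z, C(Z, ℂ))) (f : Lp ℂ 2 ν) :
    integralOperator ν k f =ᵐ[ν] fun x => inner ℂ (kernelFamily ν k x) f :=
  BoundedContinuousFunction.coeFn_toLp 2 ν ℂ _

theorem inner_kernelFamily (k : C(Z, C(Z, ℂ))) (f : Lp ℂ 2 ν) (x : Z) :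
    inner ℂ (kernelFamily ν k x) f = ∫ y, f y * star (k x y) ∂ν := by
  rw [L2.inner_def]
  refine integral_congr_ae ?_
  filter_upwards [ContinuousMap.coeFn_toLp (p := 2) ν (𝕜 := ℂ) (k x)] with y hy
  rw [RCLike.inner_apply]
  change _ * star ((ContinuousMap.toLp 2 ν ℂ (k x)) y) = _
  rw [hy]

theorem isSymmetric_integralOperator [SecondCountableTopology Z] (k : C(Z, C(Z, ℂ)))
    (hk : ∀ x y, k x y = star (k y x)) :
    (integralOperator ν k : Lp ℂ 2 ν →ₗ[ℂ] Lp ℂ 2 ν).IsSymmetric := by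
  intro f g
  have hf : Integrable f ν := (Lp.memLp f).integrable one_le_two
  have hg : Integrable g ν := (Lp.memLp g).integrable one_le_two
  have h1 : inner ℂ (integralOperator ν k f) g = ∫ x, ∫ y, k x y * (star (f y) * g x) ∂ν ∂ν := by
    rw [L2.inner_def]
    refine integral_congr_ae ?_
    filter_upwards [coeFn_integralOperator ν k f] with x hx
    rw [RCLike.inner_apply, hx, inner_kernelFamily, ← integral_conj, ← integral_const_mul]
    refine integral_congr_ae (.of_forall fun y => ?_)
    simp
    ring
  have h2 : inner ℂ f (integralOperator ν k g) = ∫ y, ∫ x, k x y * (star (f y) * g x) ∂ν ∂ν := by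
    rw [L2.inner_def]
    refine integral_congr_ae ?_
    filter_upwards [coeFn_integralOperator ν k g] with y hy
    rw [RCLike.inner_apply, hy, inner_kernelFamily, ← integral_mul_const]
    refine integral_congr_ae (.of_forall fun x => ?_)
    simp only [hk x y, RCLike.star_def]
    ring
  change inner ℂ (integralOperator ν k f) g = inner ℂ f (integralOperator ν k g)
  rw [h1, h2]
  refine integral_integral_swap ?_
  have hprod : Integrable (fun p : Z × Z => star (f p.2) * g p.1) (ν.prod ν) := by
    have hf_star : Integrable (fun y => star (f y)) ν :=
      (Complex.conjCLE : ℂ →L[ℝ] ℂ).integrable_comp hf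
    have := hg.mul_prod hf_star
    refine this.congr (.of_forall fun p => ?_)
    simp [mul_comm]
  have hkc : Continuous fun p : Z × Z => k p.1 p.2 := by fun_prop
  let kb : (Z × Z) →ᵇ ℂ := BoundedContinuousFunction.mkOfCompact ⟨_, hkc⟩
  exact hprod.bdd_mul (c := ‖kb‖) hkc.aestronglyMeasurable
    (.of_forall fun p => kb.norm_coe_le_norm p)

/-- An integral operator whose kernel is invariant under a measure-preserving map commutes with the
Koopman operator. -/
theorem integralOperator_comp {τ : Z → Z} (hτ : MeasurePreserving τ ν ν)
    (k : C(Z, C(Z, ℂ))) (hk : ∀ x y, k (τ x) (τ y) = k x y) (f : Lp ℂ 2 ν) :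
    integralOperator ν k (Lp.compMeasurePreservingₗᵢ ℂ τ hτ f) =
      Lp.compMeasurePreservingₗᵢ ℂ τ hτ (integralOperator ν k f) := by
  have h (x : Z) : Lp.compMeasurePreservingₗᵢ ℂ τ hτ (kernelFamily ν k (τ x)) =
      kernelFamily ν k x := by
    apply Lp.ext
    have h1 := Lp.coeFn_compMeasurePreserving (kernelFamily ν k (τ x)) hτ
    have h2 := hτ.quasiMeasurePreserving.ae
      (ContinuousMap.coeFn_toLp (p := 2) ν (𝕜 := ℂ) (k (τ x)))
    have h3 := ContinuousMap.coeFn_toLp (p := 2) ν (𝕜 := ℂ) (k x)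
    filter_upwards [h1, h2, h3] with y h1 h2 h3
    refine h1.trans (h2.trans (Eq.trans ?_ h3.symm))
    exact hk x y
  apply Lp.ext
  have h1 := Lp.coeFn_compMeasurePreserving (integralOperator ν k f) hτ
  have h2 := hτ.quasiMeasurePreserving.ae (coeFn_integralOperator ν k f)
  filter_upwards [coeFn_integralOperator ν k (Lp.compMeasurePreservingₗᵢ ℂ τ hτ f), h1, h2]
    with x hx h1 h2
  refine hx.trans (Eq.trans ?_ (h1.trans h2).symm)
  rw [← h x, LinearIsometry.inner_map_map]

end IntegralOperator

/-! ### The spectrum of an isometry of a compact space -/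

section IsometricSystem

variable {Z : Type*} [MetricSpace Z] [CompactSpace Z] [MeasurableSpace Z] [BorelSpace Z]
  (ν : Measure Z) [IsProbabilityMeasure ν] [ν.IsOpenPosMeasure] {τ : Z → Z} {z₀ : Z}

/-- Averaging kernels that depend on the distance only approximate the identity on continuous
functions. They can be normalized by a constant, because the integral of a function of `dist x y`
over `y` is the same for all `x` in the dense orbit. -/
theorem exists_invariant_kernel_approx (hτ : Isometry τ) (hν : MeasurePreserving τ ν ν)
    (hz : DenseRange fun n : ℕ => τ^[n] z₀) (g : C(Z, ℂ)) {ε : ℝ} (hε : 0 < ε) :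
    ∃ k : C(Z, C(Z, ℂ)), (∀ x y, k x y = star (k y x)) ∧ (∀ x y, k (τ x) (τ y) = k x y) ∧
      ∀ x, ‖(∫ y, g y * star (k x y) ∂ν) - g x‖ ≤ ε := by
  obtain ⟨δ, hδ, hgδ⟩ := Metric.uniformContinuous_iff.1
    (CompactSpace.uniformContinuous_of_continuous g.continuous) ε hε
  let φ : C(Z × Z, ℝ) := ⟨fun p => max 0 (δ - dist p.1 p.2), by fun_prop⟩
  have hφ (x y : Z) : φ (x, y) = max 0 (δ - dist x y) := rfl
  have hφ_nonneg (x y : Z) : 0 ≤ φ (x, y) := le_max_left _ _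
  have hint (x : Z) : Integrable (fun y => φ (x, y)) ν :=
    (Continuous.integrable_of_hasCompactSupport (by fun_prop) (HasCompactSupport.of_compactSpace _))
  let J : Z → ℝ := fun x => ∫ y, φ (x, y) ∂ν
  have hJ_cont : Continuous J := by
    have h1 : Continuous fun p : Z × Z => φ p := φ.continuous
    simpa [J] using continuous_parametric_integral_of_continuous (μ := ν) (f := fun x y => φ (x, y))
      (by simpa [Function.uncurry_def] using h1) isCompact_univ
  -- Substitute `y ↦ τ y` in the integral and use that `τ` is an isometry.
  have hJτ (x : Z) : J (τ x) = J x := by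
    simp only [J]
    rw [← hν.map_eq, integral_map hν.aemeasurable (by fun_prop), hν.map_eq]
    simp [hφ, hτ.dist_eq]
  have hJ (x : Z) : J x = J z₀ := by
    have h : J = fun _ => J z₀ := by
      refine hz.equalizer hJ_cont continuous_const (funext fun n => ?_)
      induction n with
      | zero => rfl
      | succ n ih => simpa [Function.iterate_succ_apply', hJτ] using ih
    exact congrFun h x
  have hJ_pos : 0 < J z₀ := by
    refine Continuous.integral_pos_of_hasCompactSupport_nonneg_nonzero (x := z₀) (by fun_prop)
      (HasCompactSupport.of_compactSpace _) (fun y => hφ_nonneg _ _) ?_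
    simp [hφ, hδ.ne', hδ.le]
  set c := J z₀ with hc
  let k : C(Z, C(Z, ℂ)) := ContinuousMap.curry ⟨fun p => ((φ p / c : ℝ) : ℂ), by fun_prop⟩
  have hk (x y : Z) : k x y = ((φ (x, y) / c : ℝ) : ℂ) := rfl
  refine ⟨k, fun x y => ?_, fun x y => ?_, fun x => ?_⟩
  · simp [hk, hφ, dist_comm x y]
  · simp [hk, hφ, hτ.dist_eq]
  · have hgk : Integrable (fun y => g y * star (k x y)) ν :=
      Continuous.integrable_of_hasCompactSupport (by fun_prop) (HasCompactSupport.of_compactSpace _)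
    have h1 : ∫ y, (φ (x, y) / c) ∂ν = 1 := by
      rw [integral_div]
      change J x / c = 1
      rw [hJ x, div_self hJ_pos.ne']
    have h2 : g x = ∫ y, g x * star (k x y) ∂ν := by
      have h3 (y : Z) : g x * star (k x y) = g x * ((φ (x, y) / c : ℝ) : ℂ) := by simp [hk]
      simp_rw [h3]
      rw [integral_const_mul, integral_complex_ofReal, h1]
      simp
    have hgx : Integrable (fun y => g x * star (k x y)) ν :=
      Continuous.integrable_of_hasCompactSupport (by fun_prop) (HasCompactSupport.of_compactSpace _)
    rw [h2, ← integral_sub hgk hgx]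
    calc ‖∫ y, (g y * star (k x y) - g x * star (k x y)) ∂ν‖
        ≤ ∫ y, ε * (φ (x, y) / c) ∂ν := by
          refine norm_integral_le_of_norm_le (((hint x).div_const c).const_mul ε)
            (.of_forall fun y => ?_)
          have hnorm : ‖k x y‖ = φ (x, y) / c := by
            rw [hk, Complex.norm_real, Real.norm_of_nonneg (div_nonneg (hφ_nonneg _ _) hJ_pos.le)]
          rw [← sub_mul, norm_mul, norm_star, hnorm]
          rcases lt_or_ge (dist x y) δ with hxy | hxy
          · gcongr
            · exact div_nonneg (hφ_nonneg _ _) hJ_pos.le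
            · rw [← dist_eq_norm, dist_comm]
              exact (hgδ hxy).le
          · have : φ (x, y) = 0 := by rw [hφ, max_eq_left (by linarith)]
            simp [this]
      _ = ε := by rw [integral_const_mul, h1, mul_one]

omit [ν.IsOpenPosMeasure] in
theorem norm_integralOperator_toLp_sub_le (k : C(Z, C(Z, ℂ))) (g : C(Z, ℂ)) {ε : ℝ} (hε : 0 < ε)
    (hkg : ∀ x, ‖(∫ y, g y * star (k x y) ∂ν) - g x‖ ≤ ε) :
    ‖integralOperator ν k (ContinuousMap.toLp 2 ν ℂ g) - ContinuousMap.toLp 2 ν ℂ g‖ ≤ ε := by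
  have hg : ContinuousMap.toLp 2 ν ℂ g =ᵐ[ν] g := ContinuousMap.coeFn_toLp (p := 2) ν (𝕜 := ℂ) g
  generalize ContinuousMap.toLp 2 ν ℂ g = G at hg
  have h := Lp.norm_le_of_ae_bound (p := 2) (f := integralOperator ν k G - G) hε.le (by
    filter_upwards [Lp.coeFn_sub (integralOperator ν k G) G, coeFn_integralOperator ν k G, hg]
      with x h1 h2 h3
    rw [h1, Pi.sub_apply, h2, h3, inner_kernelFamily]
    refine le_trans (le_of_eq ?_) (hkg x)
    congr 2
    refine integral_congr_ae ?_
    filter_upwards [hg] with y hy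
    rw [hy])
  have hone : measureUnivNNReal ν = 1 := by
    rw [← ENNReal.coe_inj, coe_measureUnivNNReal, measure_univ, ENNReal.coe_one]
  simpa [hone] using h

/-- Let `K` be an integral operator with invariant kernel and `K g` close to `g`. Then `K f = 0`,
so `⟪f, g⟫ = ⟪f, g - K g⟫`, which is small. -/
theorem norm_inner_toLp_le_of_mem_orthogonal (hτ : Isometry τ) (hν : MeasurePreserving τ ν ν)
    (hz : DenseRange fun n : ℕ => τ^[n] z₀) {f : Lp ℂ 2 ν}
    (hf : f ∈ (⨆ c : ℂ, eigenspace (koopman hν) c)ᗮ) (g : C(Z, ℂ)) {ε : ℝ} (hε : 0 < ε) :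
    ‖inner ℂ f (ContinuousMap.toLp 2 ν ℂ g)‖ ≤ ‖f‖ * ε := by
  obtain ⟨k, hk, hkτ, hkg⟩ := exists_invariant_kernel_approx ν hτ hν hz g hε
  have hdiff := norm_integralOperator_toLp_sub_le ν k g hε hkg
  generalize ContinuousMap.toLp 2 ν ℂ g = G at hdiff ⊢
  have hK := isCompactOperator_integralOperator ν k
  have hsymm := isSymmetric_integralOperator ν k hk
  have hcomm := integralOperator_comp ν hν k hkτ
  generalize integralOperator ν k = K at hdiff hK hsymm hcomm
  have hKf : K f = 0 :=
    eq_zero_of_isCompactOperator_of_commute _ K hK hsymm hcomm hf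
  have hKG : inner ℂ f (K G) = 0 := by
    have h : inner ℂ (K f) G = inner ℂ f (K G) := hsymm f G
    rw [← h, hKf, inner_zero_left]
  calc ‖inner ℂ f G‖ = ‖inner ℂ f (K G - G)‖ := by
        rw [inner_sub_right, hKG, zero_sub, norm_neg]
    _ ≤ ‖f‖ * ‖K G - G‖ := norm_inner_le_norm _ _
    _ ≤ ‖f‖ * ε := by gcongr

/-- An isometry of a compact space with a dense orbit has purely discrete spectrum. -/
theorem hasPurelyDiscreteSpectrum_of_isometry (hτ : Isometry τ) (hν : MeasurePreserving τ ν ν)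
    (hz : DenseRange fun n : ℕ => τ^[n] z₀) : HasPurelyDiscreteSpectrum hν := by
  rw [HasPurelyDiscreteSpectrum, Submodule.topologicalClosure_eq_top_iff, Submodule.eq_bot_iff]
  intro f hf
  have hcont : ∀ g : C(Z, ℂ), inner ℂ f (ContinuousMap.toLp 2 ν ℂ g) = 0 := by
    intro g
    refine norm_le_zero_iff.1 (le_of_forall_pos_le_add fun ε hε => ?_)
    refine (norm_inner_toLp_le_of_mem_orthogonal ν hτ hν hz hf g
      (ε := ε / (‖f‖ + 1)) (by positivity)).trans ?_
    rw [mul_div_assoc', div_le_iff₀ (by positivity)]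
    nlinarith
  have hzero : (fun g : Lp ℂ 2 ν => inner ℂ f g) = fun _ => 0 :=
    (ContinuousMap.toLp_denseRange ℂ ν ℂ (by norm_num : (2 : ENNReal) ≠ ⊤)).equalizer
      (by fun_prop) continuous_const (funext hcont)
  exact inner_self_eq_zero.1 (congrFun hzero f)

end IsometricSystem

/-! ### Isometric factors -/

/-- For an ergodic measure of full support, almost every orbit is dense. -/
theorem ae_denseRange_iterate_of_ergodic {Z : Type*} [TopologicalSpace Z]
    [SecondCountableTopology Z] [MeasurableSpace Z] [OpensMeasurableSpace Z] {ν : Measure Z}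
    [IsFiniteMeasure ν] [ν.IsOpenPosMeasure] {τ : Z → Z} (hτ : Ergodic τ ν) :
    ∀ᵐ z ∂ν, DenseRange fun n : ℕ => τ^[n] z := by
  have hb := TopologicalSpace.isBasis_countableBasis Z
  have key : ∀ U ∈ TopologicalSpace.countableBasis Z, ∀ᵐ z ∂ν, ∃ n : ℕ, τ^[n] z ∈ U := by
    intro U hU
    have hUo : IsOpen U := hb.isOpen hU
    set V : Set Z := ⋃ n : ℕ, τ^[n] ⁻¹' U with hV
    have hVm : MeasurableSet V :=
      MeasurableSet.iUnion fun n => hτ.measurable.iterate n hUo.measurableSet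
    have hsub : τ ⁻¹' V ⊆ V := by
      intro z hz
      obtain ⟨n, hn⟩ := Set.mem_iUnion.1 hz
      exact Set.mem_iUnion.2 ⟨n + 1, hn⟩
    have hUV : U ⊆ V := Set.subset_iUnion (fun n : ℕ => τ^[n] ⁻¹' U) 0
    rcases hτ.ae_empty_or_univ_of_preimage_ae_le hVm.nullMeasurableSet hsub.eventuallyLE with h | h
    · have h0 : ν U = 0 := measure_mono_null hUV (ae_eq_empty.1 h)
      exact absurd h0 (hUo.measure_ne_zero ν (TopologicalSpace.nonempty_of_mem_countableBasis hU))
    · filter_upwards [Filter.eventuallyEq_univ.1 h] with z hz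
      exact Set.mem_iUnion.1 hz
  filter_upwards [(ae_ball_iff (TopologicalSpace.countable_countableBasis Z)).2 key] with z hz
  refine hb.dense_iff.2 fun U hU _ => ?_
  obtain ⟨n, hn⟩ := hz U hU
  exact ⟨τ^[n] z, hn, n, rfl⟩

/-- If an isometry with a dense orbit preserves a finite measure of full support, then balls of a
given radius have measure bounded below, so the space is totally bounded. -/
theorem totallyBounded_univ_of_isometry {Z : Type*} [PseudoMetricSpace Z] [MeasurableSpace Z]
    [OpensMeasurableSpace Z] {ν : Measure Z} [IsFiniteMeasure ν] [ν.IsOpenPosMeasure] {τ : Z → Z}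
    (hτ : Isometry τ) (hν : MeasurePreserving τ ν ν) {z₀ : Z}
    (hz : DenseRange fun n : ℕ => τ^[n] z₀) : TotallyBounded (Set.univ : Set Z) := by
  have horbit (n : ℕ) (r : ℝ) : ν (Metric.ball (τ^[n] z₀) r) = ν (Metric.ball z₀ r) := by
    induction n with
    | zero => rfl
    | succ n ih =>
      rw [Function.iterate_succ_apply', ← ih,
        ← hν.measure_preimage Metric.isOpen_ball.measurableSet.nullMeasurableSet,
        hτ.preimage_ball]
  have hball (z : Z) {r : ℝ} (hr : 0 < r) : ν (Metric.ball z₀ r) ≤ ν (Metric.ball z (r + r)) := by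
    obtain ⟨n, hn⟩ := hz.exists_dist_lt z hr
    rw [← horbit n]
    refine measure_mono (Metric.ball_subset_ball' ?_)
    rw [dist_comm]
    gcongr
  -- Otherwise there is an infinite `ε`-separated sequence, and the disjoint balls of radius `ε / 2`
  -- around its points all have at least the measure of `ball z₀ (ε / 4)`.
  rw [Metric.totallyBounded_iff]
  by_contra! hcon
  obtain ⟨ε, hε, hcover⟩ := hcon
  obtain ⟨u, -, hu⟩ := exists_seq_of_forall_finset_exists (fun _ : Z => True)
    (fun x y => ε ≤ dist y x) (fun s _ => by
      obtain ⟨y, -, hy⟩ := Set.not_subset.1 (hcover s s.finite_toSet)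
      refine ⟨y, trivial, fun x hx => ?_⟩
      simp only [Set.mem_iUnion, Metric.mem_ball, not_exists, not_lt] at hy
      exact hy x hx)
  have hdisj : Pairwise (Function.onFun Disjoint fun n => Metric.ball (u n) (ε / 2)) := by
    intro m n hmn
    refine Metric.ball_disjoint_ball ?_
    rw [add_halves]
    rcases lt_or_gt_of_ne hmn with h | h
    · rw [dist_comm]; exact hu m n h
    · exact hu n m h
  have hpos : 0 < ν (Metric.ball z₀ (ε / 4)) := Metric.measure_ball_pos ν z₀ (by positivity)
  have hfin := Measure.finite_const_le_meas_of_disjoint_iUnion ν hpos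
    (fun n => Metric.isOpen_ball.measurableSet) hdisj (measure_ne_top ν _)
  refine Set.infinite_univ (hfin.subset fun n _ => ?_)
  have h := hball (u n) (r := ε / 4) (by positivity)
  rwa [show ε / 4 + ε / 4 = ε / 2 by ring] at h

theorem exists_isometry_extending {A Z : Type*} [MetricSpace Z] [CompleteSpace Z] {i j : A → Z}
    (hi : DenseRange i) (hij : ∀ a b, dist (j a) (j b) = dist (i a) (i b)) :
    ∃ τ : Z → Z, Isometry τ ∧ ∀ a, τ (i a) = j a := by
  let : PseudoMetricSpace A := PseudoMetricSpace.induced i inferInstance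
  have hi_ind : IsUniformInducing i := ⟨rfl⟩
  have hj : Isometry j := Isometry.of_dist_eq hij
  have hcont := (uniformContinuous_uniformly_extend hi_ind hi hj.uniformContinuous).continuous
  have hext (a : A) := uniformly_extend_of_ind hi_ind hi hj.uniformContinuous a
  refine ⟨_, Isometry.of_dist_eq fun x y => ?_, hext⟩
  refine hi.induction_on₂ (p := fun x y => dist ((hi_ind.isDenseInducing hi).extend j x)
    ((hi_ind.isDenseInducing hi).extend j y) = dist x y) ?_ (fun a b => ?_) x y
  · exact isClosed_eq (by fun_prop) (by fun_prop)
  · rw [hext, hext, hij]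

/-- A factor of `(X, μ, T)`, with factor map `π`, on which the transformation is an isometry `τ`
of a metric space and the image of `μ` has full support. -/
structure IsIsometricFactor {X Z : Type*} [MeasurableSpace X] (μ : Measure X) (T : X → X)
    [MetricSpace Z] [MeasurableSpace Z] (τ : Z → Z) (π : X → Z) : Prop where
  measurable : Measurable π
  isometry : Isometry τ
  semiconj : ∀ᵐ x ∂μ, π (T x) = τ (π x)
  isOpenPosMeasure : (μ.map π).IsOpenPosMeasure

namespace IsIsometricFactor

variable {X Z : Type*} [MeasurableSpace X] {μ : Measure X} {T : X → X}
    [MetricSpace Z] [MeasurableSpace Z] [BorelSpace Z] {τ : Z → Z} {π : X → Z}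

omit [BorelSpace Z] in
theorem measurePreserving_map (h : IsIsometricFactor μ T τ π) : MeasurePreserving π μ (μ.map π) :=
  ⟨h.measurable, rfl⟩

theorem measurePreserving (h : IsIsometricFactor μ T τ π) (hT : MeasurePreserving T μ μ) :
    MeasurePreserving τ (μ.map π) (μ.map π) := by
  have hτ : Measurable τ := h.isometry.continuous.measurable
  refine ⟨hτ, ?_⟩
  rw [Measure.map_map hτ h.measurable]
  calc μ.map (τ ∘ π) = μ.map (π ∘ T) := (Measure.map_congr h.semiconj).symm
    _ = (μ.map T).map π := (Measure.map_map h.measurable hT.measurable).symm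
    _ = μ.map π := by rw [hT.map_eq]

theorem ergodic (h : IsIsometricFactor μ T τ π) (hT : Ergodic T μ) : Ergodic τ (μ.map π) := by
  refine ⟨h.measurePreserving hT.toMeasurePreserving, ⟨fun s hs hinv => ?_⟩⟩
  have hpre : T ⁻¹' (π ⁻¹' s) =ᵐ[μ] π ⁻¹' s := by
    filter_upwards [h.semiconj] with x hx
    refine propext ?_
    change π (T x) ∈ s ↔ π x ∈ s
    rw [hx]
    exact Set.ext_iff.1 hinv (π x)
  have h2 := hT.quasiErgodic.ae_mem_or_ae_notMem₀ (h.measurable hs).nullMeasurableSet hpre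
  rw [Filter.eventuallyConst_set]
  rcases h2 with h2 | h2
  · exact .inl ((ae_map_iff h.measurable.aemeasurable hs).2 h2)
  · exact .inr ((ae_map_iff h.measurable.aemeasurable hs.compl).2 h2)

theorem exists_denseRange [IsProbabilityMeasure μ] [SecondCountableTopology Z]
    (h : IsIsometricFactor μ T τ π) (hT : Ergodic T μ) :
    ∃ z₀, DenseRange fun n : ℕ => τ^[n] z₀ := by
  have := h.isOpenPosMeasure
  have := Measure.isProbabilityMeasure_map (μ := μ) h.measurable.aemeasurable
  exact (ae_denseRange_iterate_of_ergodic (h.ergodic hT)).exists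

theorem compactSpace [IsProbabilityMeasure μ] [SecondCountableTopology Z] [CompleteSpace Z]
    (h : IsIsometricFactor μ T τ π) (hT : Ergodic T μ) : CompactSpace Z := by
  have := h.isOpenPosMeasure
  obtain ⟨z₀, hz⟩ := h.exists_denseRange hT
  exact ⟨isCompact_iff_totallyBounded_isComplete.2 ⟨totallyBounded_univ_of_isometry h.isometry
    (h.measurePreserving hT.toMeasurePreserving) hz, isComplete_univ⟩⟩

end IsIsometricFactor

/-- If almost all distances between the values of `p` are `T`-invariant, then `T` induces an
isometry on the support of the distribution of `p`. The invariance holds for *all* pairs of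
points from a set of full measure, because two such points can be compared through a third one
that is generic for both of them and close to the first. -/
theorem exists_isIsometricFactor_support {X Y : Type*} [MeasurableSpace X] {μ : Measure X}
    [IsProbabilityMeasure μ] {T : X → X} (hT : MeasurePreserving T μ μ) [MetricSpace Y]
    [CompleteSpace Y] [SecondCountableTopology Y] [MeasurableSpace Y] [BorelSpace Y] {p : X → Y}
    (hp : Measurable p)
    (h : ∀ᵐ q ∂μ.prod μ, dist (p (T q.1)) (p (T q.2)) = dist (p q.1) (p q.2)) :
    ∃ (π : X → (μ.map p).support) (τ : (μ.map p).support → (μ.map p).support),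
      IsIsometricFactor μ T τ π ∧ ∀ᵐ x ∂μ, (π x : Y) = p x := by
  have := Measure.isProbabilityMeasure_map (μ := μ) hp.aemeasurable
  set Z : Set Y := (μ.map p).support with hZ
  have hZm : MeasurableSet Z := Measure.isClosed_support.measurableSet
  have hZae : ∀ᵐ x ∂μ, p x ∈ Z := ae_of_ae_map hp.aemeasurable Measure.support_mem_ae
  obtain ⟨y₀, hy₀⟩ : Z.Nonempty := Measure.nonempty_support (IsProbabilityMeasure.ne_zero _)
  classical
  let π : X → Z := fun x => ⟨if p x ∈ Z then p x else y₀, by split_ifs with hx <;> assumption⟩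
  have hπm : Measurable π := ((hp.ite (hp hZm) measurable_const)).subtype_mk
  have hπ (x : X) (hx : p x ∈ Z) : (π x : Y) = p x := if_pos hx
  let A : Set X := {x | p x ∈ Z ∧ p (T x) ∈ Z ∧
    ∀ᵐ y ∂μ, dist (p (T x)) (p (T y)) = dist (p x) (p y)}
  have hA : ∀ᵐ x ∂μ, x ∈ A := by
    filter_upwards [hZae, hT.quasiMeasurePreserving.ae hZae, Measure.ae_ae_of_ae_prod h]
      with x h1 h2 h3 using ⟨h1, h2, h3⟩
  have hfreq {z : Y} (hz : z ∈ Z) {ε : ℝ} (hε : 0 < ε) : ∃ᵐ x ∂μ, dist (p x) z < ε := by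
    have hpos := (Measure.mem_support_iff_forall z).1 hz _ (Metric.ball_mem_nhds z hε)
    rw [Measure.map_apply hp Metric.isOpen_ball.measurableSet] at hpos
    exact frequently_ae_iff.2 hpos.ne'
  have hdense : DenseRange fun a : A => π a := by
    refine Metric.denseRange_iff.2 fun z ε hε => ?_
    obtain ⟨x, hx, hxA⟩ := ((hfreq z.2 hε).and_eventually hA).exists
    refine ⟨⟨x, hxA⟩, ?_⟩
    rw [Subtype.dist_eq, hπ x hxA.1, dist_comm]
    exact hx
  have hdist (a b : A) : dist (π (T a)) (π (T b)) = dist (π a) (π b) := by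
    rw [Subtype.dist_eq, Subtype.dist_eq, hπ _ a.2.1, hπ _ a.2.2.1, hπ _ b.2.1, hπ _ b.2.2.1]
    refine eq_of_forall_dist_le fun ε hε => ?_
    obtain ⟨y, hy, hya, hyb⟩ :=
      ((hfreq a.2.1 (half_pos hε)).and_eventually (a.2.2.2.and b.2.2.2)).exists
    rw [dist_comm] at hy
    have h1 := dist_triangle (p (T a)) (p (T y)) (p (T b))
    have h2 := dist_triangle (p (T y)) (p (T a)) (p (T b))
    have h3 := dist_triangle (p a) (p y) (p b)
    have h4 := dist_triangle (p y) (p a) (p b)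
    rw [dist_comm (p (T y)) (p (T a))] at h2
    rw [dist_comm (p y) (p a)] at h4
    rw [dist_comm (p (T y)) (p (T b))] at h1 h2
    rw [dist_comm (p y) (p b)] at h3 h4
    rw [Real.dist_eq, abs_le]
    constructor <;> linarith
  have : CompleteSpace Z := Measure.isClosed_support.completeSpace_coe
  obtain ⟨τ, hτ, hτπ⟩ := exists_isometry_extending hdense hdist
  refine ⟨π, τ, ⟨hπm, hτ, ?_, ⟨fun U hU hne => ?_⟩⟩, ?_⟩
  · filter_upwards [hA] with x hx using (hτπ ⟨x, hx⟩).symm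
  · obtain ⟨z, hz⟩ := hne
    obtain ⟨ε, hε, hball⟩ := Metric.isOpen_iff.1 hU z hz
    rw [Measure.map_apply hπm hU.measurableSet]
    refine frequently_ae_iff.1 (((hfreq z.2 hε).and_eventually hZae).mono fun x hx => ?_)
    refine hball ?_
    rw [Metric.mem_ball, Subtype.dist_eq, hπ x hx.2]
    exact hx.1
  · filter_upwards [hZae] with x hx using hπ x hx

/-! ### Isometries as translations on compact groups -/

/-- A finite measure on a compact group that is invariant under translation by `g` is invariant
under all translations if the powers of `g` are dense. -/
theorem isMulLeftInvariant_of_denseRange_pow {G : Type*} [Group G] [TopologicalSpace G]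
    [IsTopologicalGroup G] [CompactSpace G] [FirstCountableTopology G] [HasOuterApproxClosed G]
    [MeasurableSpace G] [BorelSpace G] {m : Measure G} [IsFiniteMeasure m] {g : G}
    (hg : DenseRange fun n : ℕ => g ^ n) (hm : MeasurePreserving (g * ·) m m) :
    m.IsMulLeftInvariant := by
  refine ⟨fun x => ?_⟩
  have hmeas (x : G) : Measurable (x * ·) := (continuous_const_mul x).measurable
  have : IsFiniteMeasure (m.map (x * ·)) := Measure.isFiniteMeasure_map m _
  refine ext_of_forall_integral_eq_of_IsFiniteMeasure fun f => ?_
  have hcont : Continuous fun x => ∫ y, f (x * y) ∂m := by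
    simpa using continuous_parametric_integral_of_continuous (μ := m) (f := fun x y => f (x * y))
      (by fun_prop) isCompact_univ
  have hpow (n : ℕ) : ∫ y, f (g ^ n * y) ∂m = ∫ y, f y ∂m := by
    have h := hm.iterate n
    rw [mul_left_iterate] at h
    rw [← integral_map (φ := (g ^ n * ·)) h.aemeasurable (f := f) (by fun_prop), h.map_eq]
  have h := hg.equalizer hcont (continuous_const (y := ∫ y, f y ∂m)) (funext hpow)
  rw [integral_map (hmeas x).aemeasurable (by fun_prop)]
  exact congrFun h x

section Rotation

variable {Z : Type*} [MetricSpace Z] [CompactSpace Z] [MeasurableSpace Z] [BorelSpace Z]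
  {ν : Measure Z} [IsProbabilityMeasure ν] [ν.IsOpenPosMeasure] {τ : Z → Z} {z₀ : Z}

/-- If an abelian group `A` maps isometrically into a compact space `Z` so that `τ` is given by
adding `a`, then the completion of `A` is a compact group that can be identified with `Z`, and `τ`
becomes a translation. -/
theorem exists_rotation_of_isometric_group {A : Type} [SeminormedAddCommGroup A] {j : A → Z}
    (hj : Isometry j) (hj0 : j 0 = z₀) {a : A} (hja : ∀ b, τ (j b) = j (a + b))
    (hτ : Continuous τ) (hν : MeasurePreserving τ ν ν)
    (hz : DenseRange fun n : ℕ => τ^[n] z₀) :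
    ∃ (G : Type) (_ : CommGroup G) (_ : TopologicalSpace G) (_ : IsTopologicalGroup G)
      (_ : CompactSpace G) (_ : T2Space G) (_ : MeasurableSpace G) (_ : BorelSpace G)
      (m : Measure G) (_ : m.IsHaarMeasure) (_ : IsProbabilityMeasure m) (g : G),
      Dense (Subgroup.zpowers g : Set G) ∧
      ∃ e : Z ≃ᵐ G, MeasurePreserving e ν m ∧ ∀ z, e (τ z) = g * e z := by
  have horbit (n : ℕ) : τ^[n] z₀ = j (n • a) := by
    induction n with
    | zero => simp [hj0]
    | succ n ih => rw [Function.iterate_succ_apply', ih, hja, succ_nsmul']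
  have hjd : DenseRange j := hz.mono (by rintro _ ⟨n, rfl⟩; exact ⟨n • a, (horbit n).symm⟩)
  have hE : Isometry (Completion.extension j) := hj.completion_extension
  have hEj (b : A) : Completion.extension j (b : Completion A) = j b :=
    Completion.extension_coe hj.uniformContinuous b
  have hEs : Function.Surjective (Completion.extension j) := by
    rw [← Set.range_eq_univ, ← hE.isClosedEmbedding.isClosed_range.closure_eq]
    exact (hjd.mono (by rintro _ ⟨b, rfl⟩; exact ⟨b, hEj b⟩)).closure_eq
  let E : Completion A ≃ᵢ Z := ⟨Equiv.ofBijective _ ⟨hE.injective, hEs⟩, hE⟩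
  have : CompactSpace (Completion A) := E.toHomeomorph.symm.compactSpace
  let G := Multiplicative (Completion A)
  let : MeasurableSpace G := borel G
  have : BorelSpace G := ⟨rfl⟩
  let ψ : Z ≃ₜ G := E.toHomeomorph.symm
  let g : G := Multiplicative.ofAdd (a : Completion A)
  have hψj (b : A) : ψ (j b) = Multiplicative.ofAdd (b : Completion A) := by
    refine (E.toHomeomorph.symm_apply_eq).2 (hEj b).symm
  have hψ (z : Z) : ψ (τ z) = g * ψ z := by
    refine hjd.induction_on (p := fun z => ψ (τ z) = g * ψ z) z
      (isClosed_eq (by fun_prop) (by fun_prop)) fun b => ?_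
    rw [hja, hψj, hψj]
    exact congrArg Multiplicative.ofAdd (Completion.coe_add a b)
  have hpow (n : ℕ) : ψ (τ^[n] z₀) = g ^ n := by
    induction n with
    | zero =>
      rw [Function.iterate_zero_apply, ← hj0, hψj, pow_zero]
      exact congrArg Multiplicative.ofAdd Completion.coe_zero
    | succ n ih => rw [Function.iterate_succ_apply', hψ, ih, pow_succ']
  have hg : DenseRange fun n : ℕ => g ^ n := by
    simpa [Function.comp_def, hpow] using ψ.surjective.denseRange.comp hz ψ.continuous
  let e : Z ≃ᵐ G := ψ.toMeasurableEquiv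
  have he : MeasurePreserving e ν (ν.map e) := ⟨e.measurable, rfl⟩
  have : IsProbabilityMeasure (ν.map e) :=
    Measure.isProbabilityMeasure_map e.measurable.aemeasurable
  have hm : MeasurePreserving (g * ·) (ν.map e) (ν.map e) := by
    refine ⟨(continuous_const_mul g).measurable, ?_⟩
    rw [Measure.map_map (continuous_const_mul g).measurable e.measurable]
    have : (g * ·) ∘ e = e ∘ τ := funext fun z => (hψ z).symm
    rw [this, ← Measure.map_map e.measurable hτ.measurable, hν.map_eq]
  have hinv : (ν.map e).IsMulLeftInvariant := isMulLeftInvariant_of_denseRange_pow hg hm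
  have hopen : (ν.map e).IsOpenPosMeasure :=
    ψ.continuous.isOpenPosMeasure_map ψ.surjective
  refine ⟨G, inferInstance, inferInstance, inferInstance, inferInstance, inferInstance,
    inferInstance, inferInstance, ν.map e, { }, inferInstance, g, ?_, e, he, hψ⟩
  refine hg.mono ?_
  rintro _ ⟨n, rfl⟩
  exact Subgroup.npow_mem_zpowers g n

/-- An isometry of a compact space with a dense orbit is a translation on a compact abelian group:
the completion of `ℤ` for the seminorm `n ↦ dist (τⁿ z₀) z₀`. -/
theorem exists_rotation_of_isometry (hτ : Isometry τ) (hν : MeasurePreserving τ ν ν)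
    (hz : DenseRange fun n : ℕ => τ^[n] z₀) :
    ∃ (G : Type) (_ : CommGroup G) (_ : TopologicalSpace G) (_ : IsTopologicalGroup G)
      (_ : CompactSpace G) (_ : T2Space G) (_ : MeasurableSpace G) (_ : BorelSpace G)
      (m : Measure G) (_ : m.IsHaarMeasure) (_ : IsProbabilityMeasure m) (g : G),
      Dense (Subgroup.zpowers g : Set G) ∧
      ∃ e : Z ≃ᵐ G, MeasurePreserving e ν m ∧ ∀ z, e (τ z) = g * e z := by
  -- The complement of the closed set `range τ` has empty preimage, so it is null, hence empty.
  have hsurj : Function.Surjective τ := by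
    have hclosed : IsClosed (Set.range τ) := hτ.isClosedEmbedding.isClosed_range
    have h0 : ν (Set.range τ)ᶜ = 0 := by
      rw [← hν.measure_preimage hclosed.isOpen_compl.measurableSet.nullMeasurableSet]
      simp
    rw [← Set.range_eq_univ, ← Set.compl_empty_iff]
    exact (hclosed.isOpen_compl.measure_eq_zero_iff ν).1 h0
  let σ : Z ≃ᵢ Z := ⟨Equiv.ofBijective τ ⟨hτ.injective, hsurj⟩, hτ⟩
  let N : AddGroupSeminorm ℤ :=
    { toFun := fun n => dist ((σ ^ n) z₀) z₀
      map_zero' := by simp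
      add_le' := fun m n => by
        rw [zpow_add, IsometryEquiv.mul_apply]
        refine (dist_triangle _ ((σ ^ m) z₀) _).trans ?_
        rw [(σ ^ m).isometry.dist_eq, add_comm]
      neg' := fun n => by
        rw [← (σ ^ n).isometry.dist_eq, ← IsometryEquiv.mul_apply, zpow_neg, mul_inv_cancel,
          dist_comm]
        rfl }
  -- The instance is passed explicitly, since `ℤ` already carries its usual metric.
  let inst : SeminormedAddCommGroup ℤ := N.toSeminormedAddCommGroup
  refine @exists_rotation_of_isometric_group Z _ _ _ _ ν _ _ τ z₀ ℤ inst (fun n => (σ ^ n) z₀)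
    (@Isometry.of_dist_eq _ _ inst.toPseudoMetricSpace _ _ fun m n => ?_) (by rfl) 1 (fun n => ?_)
    hτ.continuous hν hz
  · change _ = dist ((σ ^ (-m + n)) z₀) z₀
    rw [← (σ ^ m).isometry.dist_eq ((σ ^ (-m + n)) z₀), ← IsometryEquiv.mul_apply, ← zpow_add,
      dist_comm, add_neg_cancel_left]
  · change (σ * σ ^ n) z₀ = (σ ^ (1 + n)) z₀
    rw [zpow_add, zpow_one]

end Rotation

/-! ### Isometric factors from admissible semimetrics -/

/-- An admissible semimetric is the pullback of the metric of a Polish space under a measurable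
map, up to a null set. -/
theorem IsAdmissibleOn.exists_measurable_map {X : Type u} [MeasurableSpace X] {μ : Measure X}
    [IsProbabilityMeasure μ] {ρ : X → X → ℝ} {S : Set X} (h : IsAdmissibleOn μ ρ S) :
    ∃ (Y : Type u) (_ : MetricSpace Y) (_ : CompleteSpace Y) (_ : SecondCountableTopology Y)
      (_ : MeasurableSpace Y) (_ : BorelSpace Y) (p : X → Y) (S' : Set X), Measurable p ∧
      S' ⊆ S ∧ (∀ᵐ x ∂μ, x ∈ S') ∧ ∀ x ∈ S', ∀ y ∈ S', dist (p x) (p y) = ρ x y := by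
  let d : PseudoMetricSpace S := h.semimetric.toPseudoMetricSpace
  let : MeasurableSpace (Completion S) := borel (Completion S)
  have hpolish : PolishSpace (Completion S) ∧
      AEMeasurable (fun x : S => (x : Completion S)) (μ.comap Subtype.val) := h.polish
  obtain ⟨_, g, hg, hfg⟩ := hpolish
  obtain ⟨x₀, hx₀⟩ := h.full.exists
  classical
  let p : X → Completion S := fun x => if hx : x ∈ S then g ⟨x, hx⟩ else g ⟨x₀, hx₀⟩
  have hp : Measurable p := by
    refine Measurable.dite (s := S) (f := g) (g := fun _ => g ⟨x₀, hx₀⟩) hg measurable_const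
      h.measurableSet
  refine ⟨Completion S, inferInstance, inferInstance, inferInstance, inferInstance, ⟨rfl⟩, p,
    {x | ∃ hx : x ∈ S, p x = ((⟨x, hx⟩ : S) : Completion S)}, hp, fun x hx => hx.1, ?_, ?_⟩
  · have hae : ∀ᵐ x : S ∂(μ.comap Subtype.val), p x = (x : Completion S) := by
      filter_upwards [hfg] with x hx
      rw [hx]
      exact dif_pos x.2
    have hae' := (MeasurableEmbedding.subtype_coe h.measurableSet).ae_map_iff
      (μ := μ.comap Subtype.val) (p := fun x => ∃ hx : x ∈ S, p x = ((⟨x, hx⟩ : S) : Completion S))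
    rw [map_comap_subtype_coe h.measurableSet, ae_restrict_iff' h.measurableSet] at hae'
    filter_upwards [hae'.2 (hae.mono fun x hx => ⟨x.2, hx⟩), h.full] with x h1 h2 using h1 h2
  · rintro x ⟨hx, hpx⟩ y ⟨hy, hpy⟩
    rw [hpx, hpy, Completion.dist_eq]
    rfl

/-- A `T`-invariant admissible semimetric comes from an isometric factor on a compact space. -/
theorem IsAdmissibleOn.exists_isIsometricFactor {X : Type u} [MeasurableSpace X] {μ : Measure X}
    [IsProbabilityMeasure μ] {ρ : X → X → ℝ} {S : Set X} (h : IsAdmissibleOn μ ρ S) {T : X → X}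
    (hT : Ergodic T μ) (hρ : IsInvariantSemimetric μ T ρ) :
    ∃ (Z : Type u) (_ : MetricSpace Z) (_ : CompactSpace Z) (_ : MeasurableSpace Z)
      (_ : BorelSpace Z) (τ : Z → Z) (π : X → Z) (S' : Set X), IsIsometricFactor μ T τ π ∧
      S' ⊆ S ∧ MeasurableSet S' ∧ (∀ᵐ x ∂μ, x ∈ S') ∧
      ∀ x ∈ S', ∀ y ∈ S', dist (π x) (π y) = ρ x y := by
  obtain ⟨Y, _, _, _, _, _, p, S₁, hp, hS₁, hS₁_full, hdist⟩ := h.exists_measurable_map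
  have hinv : ∀ᵐ q ∂μ.prod μ, dist (p (T q.1)) (p (T q.2)) = dist (p q.1) (p q.2) := by
    have hTS₁ := hT.toMeasurePreserving.quasiMeasurePreserving.ae hS₁_full
    have hfst := Measure.quasiMeasurePreserving_fst (μ := μ) (ν := μ)
    have hsnd := Measure.quasiMeasurePreserving_snd (μ := μ) (ν := μ)
    filter_upwards [hρ, hfst.ae hS₁_full, hsnd.ae hS₁_full, hfst.ae hTS₁, hsnd.ae hTS₁]
      with q hq h1 h2 h3 h4
    rw [hdist _ h1 _ h2, hdist _ h3 _ h4, hq]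
  obtain ⟨π, τ, hπ, hπp⟩ := exists_isIsometricFactor_support hT.toMeasurePreserving hp hinv
  have : CompleteSpace (μ.map p).support := Measure.isClosed_support.completeSpace_coe
  obtain ⟨S', hS', hS'm, hS'p⟩ := (hS₁_full.and hπp).exists_measurable_mem
  refine ⟨_, inferInstance, hπ.compactSpace hT, inferInstance, inferInstance, τ, π, S', hπ,
    fun x hx => hS₁ (hS'p x hx).1, hS'm, hS', fun x hx y hy => ?_⟩
  rw [Subtype.dist_eq, (hS'p x hx).2, (hS'p y hy).2, hdist _ (hS'p x hx).1 _ (hS'p y hy).1]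

/-! ### Spectra of factors -/

section Koopman

variable {X Z : Type*} [MeasurableSpace X] [MeasurableSpace Z] {μ : Measure X} {ν : Measure Z}
  {T : X → X} {τ : Z → Z} {π : X → Z}

theorem koopman_compMeasurePreserving (hT : MeasurePreserving T μ μ) (hτ : MeasurePreserving τ ν ν)
    (hπ : MeasurePreserving π μ ν) (hsemi : ∀ᵐ x ∂μ, π (T x) = τ (π x)) (f : Lp ℂ 2 ν) :
    koopman hT (Lp.compMeasurePreservingₗᵢ ℂ π hπ f) =
      Lp.compMeasurePreservingₗᵢ ℂ π hπ (koopman hτ f) := by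
  apply Lp.ext
  have h1 := Lp.coeFn_compMeasurePreserving (Lp.compMeasurePreserving π hπ f) hT
  have h2 := hT.quasiMeasurePreserving.ae (Lp.coeFn_compMeasurePreserving f hπ)
  have h3 := Lp.coeFn_compMeasurePreserving (Lp.compMeasurePreserving τ hτ f) hπ
  have h4 := hπ.quasiMeasurePreserving.ae (Lp.coeFn_compMeasurePreserving f hτ)
  filter_upwards [h1, h2, h3, h4, hsemi] with x h1 h2 h3 h4 h5
  refine h1.trans (h2.trans (Eq.trans ?_ (h3.trans h4).symm))
  exact congrArg f h5

theorem mem_eigenspace_compMeasurePreserving (hT : MeasurePreserving T μ μ)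
    (hτ : MeasurePreserving τ ν ν) (hπ : MeasurePreserving π μ ν)
    (hsemi : ∀ᵐ x ∂μ, π (T x) = τ (π x)) {c : ℂ} {f : Lp ℂ 2 ν}
    (hf : f ∈ eigenspace (koopman hτ) c) :
    Lp.compMeasurePreservingₗᵢ ℂ π hπ f ∈ eigenspace (koopman hT) c := by
  rw [mem_eigenspace_iff] at hf ⊢
  rw [koopman_compMeasurePreserving hT hτ hπ hsemi, hf, map_smul]

/-- A discrete component of the spectrum of a factor lifts to the extension. -/
theorem HasDiscreteComponent.of_factor [IsFiniteMeasure μ] [IsFiniteMeasure ν]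
    (hT : MeasurePreserving T μ μ) (hτ : MeasurePreserving τ ν ν) (hπ : MeasurePreserving π μ ν)
    (hsemi : ∀ᵐ x ∂μ, π (T x) = τ (π x)) (h : HasDiscreteComponent hτ) :
    HasDiscreteComponent hT := by
  obtain ⟨c, f, hf, hf1⟩ := h
  refine ⟨c, Lp.compMeasurePreservingₗᵢ ℂ π hπ f,
    ⟨mem_eigenspace_compMeasurePreserving hT hτ hπ hsemi hf.1, fun h0 => hf.2 ?_⟩, ?_⟩
  · exact (Lp.compMeasurePreservingₗᵢ ℂ π hπ).injective (h0.trans (map_zero _).symm)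
  · have hconst : Lp.compMeasurePreservingₗᵢ ℂ π hπ (Lp.const 2 ν (1 : ℂ)) = Lp.const 2 μ 1 := rfl
    rw [← hconst, LinearIsometry.inner_map_map, hf1]

/-- Pure discreteness of the spectrum passes along an isomorphism. -/
theorem HasPurelyDiscreteSpectrum.of_isIsoModZero {ψ : Z → X}
    (hT : MeasurePreserving T μ μ) (hτ : MeasurePreserving τ ν ν)
    (hiso : IsIsoModZero μ ν π ψ) (hsemi : ∀ᵐ x ∂μ, π (T x) = τ (π x))
    (h : HasPurelyDiscreteSpectrum hτ) : HasPurelyDiscreteSpectrum hT := by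
  rw [HasPurelyDiscreteSpectrum, eq_top_iff]
  intro f _
  let L := Lp.compMeasurePreservingₗᵢ ℂ π hiso.map (p := 2) (E := ℂ)
  let f' : Lp ℂ 2 ν := Lp.compMeasurePreserving ψ hiso.inv f
  have hf' : L f' = f := by
    apply Lp.ext
    have h1 := Lp.coeFn_compMeasurePreserving f' hiso.map
    have h2 := hiso.map.quasiMeasurePreserving.ae (Lp.coeFn_compMeasurePreserving f hiso.inv)
    filter_upwards [h1, h2, hiso.left_inv] with x h1 h2 h3
    exact h1.trans (h2.trans (congrArg f h3))
  have hmaps : (⨆ c : ℂ, eigenspace (koopman hτ) c) ≤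
      (⨆ c : ℂ, eigenspace (koopman hT) c).comap L.toLinearMap :=
    iSup_le fun c g hg => Submodule.mem_iSup_of_mem c
      (mem_eigenspace_compMeasurePreserving hT hτ hiso.map hsemi hg)
  have hmem : f' ∈ (⨆ c : ℂ, eigenspace (koopman hτ) c).topologicalClosure := by
    rw [HasPurelyDiscreteSpectrum] at h
    rw [h]
    trivial
  rw [← hf']
  exact map_mem_closure L.continuous hmem fun g hg => hmaps hg

/-- If the spectrum is purely discrete but has no discrete component outside the constants, then
there are only the constants: an eigenfunction with eigenvalue `≠ 1` is orthogonal to them, and one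
with eigenvalue `1` becomes so after subtracting its mean. -/
theorem mem_span_const_of_not_hasDiscreteComponent [IsProbabilityMeasure ν]
    (hτ : MeasurePreserving τ ν ν) (h : HasPurelyDiscreteSpectrum hτ)
    (hnot : ¬ HasDiscreteComponent hτ) (f : Lp ℂ 2 ν) :
    f ∈ Submodule.span ℂ {Lp.const 2 ν (1 : ℂ)} := by
  let U := Lp.compMeasurePreservingₗᵢ ℂ τ hτ (p := 2) (E := ℂ)
  set e : Lp ℂ 2 ν := Lp.const 2 ν (1 : ℂ) with he
  have hUe : U e = e := rfl
  have he_norm : inner ℂ e e = 1 := by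
    have hnorm : ‖e‖ = 1 := by
      simpa using Lp.norm_const' (μ := ν) (c := (1 : ℂ)) (p := 2) (by norm_num) (by norm_num)
    rw [inner_self_eq_norm_sq_to_K, hnorm]
    simp
  have hle : (⨆ c : ℂ, eigenspace (koopman hτ) c) ≤ Submodule.span ℂ {e} := by
    refine iSup_le fun c g hg => ?_
    have hUg : U g = c • g := mem_eigenspace_iff.1 hg
    by_cases hc : c = 1
    · subst hc
      have h0 : g - inner ℂ e g • e = 0 := by
        by_contra hne
        refine hnot ⟨1, g - inner ℂ e g • e, ⟨mem_eigenspace_iff.2 ?_, hne⟩, ?_⟩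
        · change U (g - inner ℂ e g • e) = _
          rw [map_sub, map_smul, hUe, hUg, one_smul, one_smul]
        · rw [inner_sub_right, inner_smul_right, he_norm, mul_one, sub_self]
      rw [sub_eq_zero.1 h0]
      exact Submodule.smul_mem _ _ (Submodule.mem_span_singleton_self e)
    · have horth : inner ℂ e g = 0 := by
        have h1 : inner ℂ e g = c * inner ℂ e g := by
          rw [← inner_smul_right, ← hUg]
          nth_rw 2 [← hUe]
          rw [LinearIsometry.inner_map_map]
        have h2 : (1 - c) * inner ℂ e g = 0 := by linear_combination h1
        exact (mul_eq_zero.1 h2).resolve_left (sub_ne_zero.2 (Ne.symm hc))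
      have h0 : g = 0 := by
        by_contra hne
        exact hnot ⟨c, g, ⟨hg, hne⟩, horth⟩
      rw [h0]
      exact Submodule.zero_mem _
  have hclosed : IsClosed (Submodule.span ℂ {e} : Set (Lp ℂ 2 ν)) :=
    Submodule.closed_of_finiteDimensional _
  rw [HasPurelyDiscreteSpectrum] at h
  exact Submodule.topologicalClosure_minimal _ hle hclosed (h ▸ Submodule.mem_top)

end Koopman

/-- A purely discrete spectrum has a discrete component as soon as the space has two points, since
the distance to a point is not constant. -/
theorem hasDiscreteComponent_of_nontrivial {Z : Type*} [MetricSpace Z] [CompactSpace Z]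
    [MeasurableSpace Z] [BorelSpace Z] {ν : Measure Z} [IsProbabilityMeasure ν]
    [ν.IsOpenPosMeasure] [Nontrivial Z] {τ : Z → Z} (hτ : MeasurePreserving τ ν ν)
    (h : HasPurelyDiscreteSpectrum hτ) : HasDiscreteComponent hτ := by
  by_contra hnot
  obtain ⟨z, w, hzw⟩ := exists_pair_ne Z
  let f : C(Z, ℂ) := ⟨fun y => (dist y z : ℂ), by fun_prop⟩
  obtain ⟨a, ha⟩ := Submodule.mem_span_singleton.1
    (mem_span_const_of_not_hasDiscreteComponent hτ h hnot (ContinuousMap.toLp 2 ν ℂ f))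
  have hae : f =ᵐ[ν] fun _ => a := by
    have h1 := ContinuousMap.coeFn_toLp (p := 2) ν (𝕜 := ℂ) f
    rw [← ha] at h1
    filter_upwards [h1, Lp.coeFn_smul a (Lp.const 2 ν (1 : ℂ)),
      Lp.coeFn_const (p := 2) (μ := ν) (1 : ℂ)] with y h1 h2 h3
    rw [← h1, h2, Pi.smul_apply, h3]
    simp
  have heq := (f.continuous.ae_eq_iff_eq ν continuous_const).1 hae
  have h2 : f w = f z := (congrFun heq w).trans (congrFun heq z).symm
  have h3 : dist w z = 0 := by simpa [f] using h2
  exact hzw (dist_eq_zero.1 h3).symm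

/-! ### Factor maps injective mod 0, and the theorem -/

/-- A measurable map that is injective on a set of full measure in a standard Borel space is an
isomorphism onto its image measure. -/
theorem exists_isIsoModZero_map {X Z : Type*} [MeasurableSpace X] [StandardBorelSpace X]
    {μ : Measure X} [IsProbabilityMeasure μ] [MeasurableSpace Z]
    [StandardBorelSpace Z] {π : X → Z} (hπ : Measurable π) {S : Set X}
    (hS : MeasurableSet S) (hfull : ∀ᵐ x ∂μ, x ∈ S) (hinj : Set.InjOn π S) :
    ∃ ψ : Z → X, IsIsoModZero μ (μ.map π) π ψ := by
  obtain ⟨x₀, -⟩ := hfull.exists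
  have := hS.standardBorel
  have hemb : MeasurableEmbedding (fun x : S => π x) :=
    (hπ.comp measurable_subtype_coe).measurableEmbedding (Set.injOn_iff_injective.1 hinj)
  -- Off the image of `S`, a null set, the value `x₀` is arbitrary.
  let ψ : Z → X := Function.extend (fun x : S => π x) Subtype.val fun _ => x₀
  have hψ : Measurable ψ := hemb.measurable_extend measurable_subtype_coe measurable_const
  have hleft : ∀ᵐ x ∂μ, ψ (π x) = x := by
    filter_upwards [hfull] with x hx
    exact hemb.injective.extend_apply Subtype.val _ (⟨x, hx⟩ : S)
  refine ⟨ψ, ⟨hπ, rfl⟩, ⟨hψ, ?_⟩, hleft, ?_⟩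
  · rw [Measure.map_map hψ hπ, Measure.map_congr (f := ψ ∘ π) (g := id) hleft, Measure.map_id]
  · refine (ae_map_iff hπ.aemeasurable (measurableSet_eq_fun (hπ.comp hψ) measurable_id)).2 ?_
    filter_upwards [hleft] with x hx using congrArg π hx

theorem proposition2 {X : Type*} [MeasurableSpace X] [StandardBorelSpace X]
    (μ : Measure X) [IsProbabilityMeasure μ] [NullSingletonClass μ]
    (T : X → X) (hT : IsAutomorphism μ T) (hE : Ergodic T μ) :
    (∀ ρ : X → X → ℝ, IsAdmissibleSemimetric μ ρ → IsInvariantSemimetric μ T ρ →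
      (¬ ∀ᵐ p ∂(μ.prod μ), ρ p.1 p.2 = 0) →
        HasDiscreteComponent hE.toMeasurePreserving) ∧
    (∀ ρ : X → X → ℝ, IsAdmissibleMetric μ ρ → IsInvariantSemimetric μ T ρ →
      HasPurelyDiscreteSpectrum hE.toMeasurePreserving ∧
      ∃ (G : Type) (_ : CommGroup G) (_ : TopologicalSpace G) (_ : IsTopologicalGroup G)
        (_ : CompactSpace G) (_ : T2Space G) (_ : MeasurableSpace G) (_ : BorelSpace G)
        (m : Measure G) (_ : m.IsHaarMeasure) (_ : IsProbabilityMeasure m) (g : G),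
        Dense (Subgroup.zpowers g : Set G) ∧
        MetricallyIsomorphic μ T m (fun x => g * x)) := by
  refine ⟨fun ρ ⟨S, hS⟩ hρ hne => ?_, fun ρ ⟨S, hS, hsep⟩ hρ => ?_⟩
  · obtain ⟨Z, _, _, _, _, τ, π, S', hπ, -, -, hfull, hdist⟩ := hS.exists_isIsometricFactor hE hρ
    have := hπ.isOpenPosMeasure
    have := Measure.isProbabilityMeasure_map (μ := μ) hπ.measurable.aemeasurable
    obtain ⟨z₀, hz₀⟩ := hπ.exists_denseRange hE
    have hν := hπ.measurePreserving hE.toMeasurePreserving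
    have : Nontrivial Z := by
      by_contra hZ
      rw [not_nontrivial_iff_subsingleton] at hZ
      refine hne ?_
      filter_upwards [Measure.quasiMeasurePreserving_fst.ae hfull,
        Measure.quasiMeasurePreserving_snd.ae hfull] with q h1 h2
      rw [← hdist _ h1 _ h2, Subsingleton.elim (π q.1) (π q.2), dist_self]
    exact (hasDiscreteComponent_of_nontrivial hν
      (hasPurelyDiscreteSpectrum_of_isometry _ hπ.isometry hν hz₀)).of_factor
        hE.toMeasurePreserving hν hπ.measurePreserving_map hπ.semiconj
  · obtain ⟨Z, _, _, _, _, τ, π, S', hπ, hS'S, hS'm, hfull, hdist⟩ :=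
      hS.exists_isIsometricFactor hE hρ
    have := hπ.isOpenPosMeasure
    have := Measure.isProbabilityMeasure_map (μ := μ) hπ.measurable.aemeasurable
    obtain ⟨z₀, hz₀⟩ := hπ.exists_denseRange hE
    have hν := hπ.measurePreserving hE.toMeasurePreserving
    have hinj : Set.InjOn π S' := fun x hx y hy hxy =>
      hsep x (hS'S hx) y (hS'S hy) (by rw [← hdist x hx y hy, hxy, dist_self])
    obtain ⟨ψ, hψ⟩ := exists_isIsoModZero_map hπ.measurable hS'm hfull hinj
    refine ⟨(hasPurelyDiscreteSpectrum_of_isometry _ hπ.isometry hν hz₀).of_isIsoModZero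
      hE.toMeasurePreserving hν hψ hπ.semiconj, ?_⟩
    obtain ⟨G, _, _, _, _, _, _, _, m, hm, hm1, g, hg, e, he, hτe⟩ :=
      exists_rotation_of_isometry hπ.isometry hν hz₀
    refine ⟨G, _, _, inferInstance, inferInstance, inferInstance, _, inferInstance, m, hm, hm1, g,
      hg, e ∘ π, ψ ∘ e.symm, ⟨he.comp hψ.map, hψ.inv.comp (he.symm e), ?_, ?_⟩, ?_⟩
    · filter_upwards [hψ.left_inv] with x hx
      simpa using hx
    · filter_upwards [(he.symm e).quasiMeasurePreserving.ae hψ.right_inv] with y hy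
      simp [hy]
    · filter_upwards [hπ.semiconj] with x hx
      simp [hx, hτe]
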